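/- Let $E=(E^0,E^1,r,s)$ be a directed graph (sets $E^0$ of vertices and $E^1$ of edges, with range and source maps $r,s:E^1\to E^0$) which is row-finite, i.e. $s^{-1}(v)$ is finite for every $v\in E^0$, and let $K$ be a field. Let $L_K(E)$ be the Leavitt path algebra: the associative, not necessarily unital, $K$-algebra generated by the vertices $v\in E^0$ and the symbols $e,e^*$ $(e\in E^1)$ subject to $vv'=\delta_{v,v'}v$; $s(e)e=er(e)=e$; $r(e)e^*=e^*s(e)=e^*$; $e^*f=\delta_{e,f}r(e)$; and $v=\sum_{s(e)=v}ee^*$ whenever $0<|s^{-1}(v)|<\infty$. It is $\mathbb Z$-graded by $\deg v=0$, $\deg e=1$, $\deg e^*=-1$; write $L_n$ for the component of degree $n$. A two-sided ideal $I$ is graded if $I=\bigoplus_{n\in\mathbb Z}(I\cap L_n)$. For $v,w\in E^0$ write $v\ge w$ if $v=w$ or there is a path from $v$ to $w$. A set $H\subseteq E^0$ is hereditary if $w\in H$ and $w\ge v$ imply $v\in H$; it is saturated if $v\in H$ whenever $0<|s^{-1}(v)|<\infty$ and $r(s^{-1}(v))\subseteq H$. The hereditary saturated closure $\overline{X}$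 of $X\subseteq E^0$ is the smallest hereditary and saturated subset of $E^0$ containing $X$. Then the following are equivalent: (1) $L_K(E)$ satisfies the ascending chain condition on two-sided ideals; (2) $L_K(E)$ satisfies the ascending chain condition on graded two-sided ideals; (3) the hereditary saturated closures $\overline{X}$ of the subsets $X\subseteq E^0$, ordered by inclusion, satisfy the ascending chain condition. -/

import Mathlib

universe u v w

/-- A directed graph with vertex set `V` and edge set `E`: every edge has a source and a range.
Loops, multiple edges and infinite sets are allowed. -/
structure DirectedGraph (V : Type u) (E : Type v) where
  /-- the source of an edge -/
  src : E → V
  /-- the range of an edge -/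
  rng : E → V

namespace DirectedGraph

variable {V : Type u} {E : Type v}

/-- The set `s⁻¹(x)` of edges emitted by the vertex `x`. -/
def emitted (G : DirectedGraph V E) (x : V) : Set E := {e | G.src e = x}

/-- Every vertex is the source of at most finitely many edges. -/
def RowFinite (G : DirectedGraph V E) : Prop := ∀ x : V, (G.emitted x).Finite

/-- The preorder `x ≥ y`: either `x = y`, or there is a path (a finite sequence of composable
edges) from `x` to `y`. -/
def Reaches (G : DirectedGraph V E) : V → V → Prop :=
  Relation.ReflTransGen (fun x y => ∃ e : E, G.src e = x ∧ G.rng e = y)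

/-- `H` is hereditary: `x ∈ H` and `x ≥ y` imply `y ∈ H`. -/
def IsHereditary (G : DirectedGraph V E) (H : Set V) : Prop :=
  ∀ x y : V, x ∈ H → G.Reaches x y → y ∈ H

/-- `H` is saturated: a vertex `x` with `0 < |s⁻¹(x)| < ∞` all of whose edges end in `H` lies
in `H`. -/
def IsSaturated (G : DirectedGraph V E) (H : Set V) : Prop :=
  ∀ x : V, (G.emitted x).Nonempty → (G.emitted x).Finite →
    G.rng '' G.emitted x ⊆ H → x ∈ H

/-- The smallest hereditary and saturated set of vertices that contains `X`
(an intersection of hereditary saturated sets is hereditary and saturated). -/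
def hsClosure (G : DirectedGraph V E) (X : Set V) : Set V :=
  ⋂₀ {H : Set V | X ⊆ H ∧ G.IsHereditary H ∧ G.IsSaturated H}

end DirectedGraph

/-- The generators of the Leavitt path algebra: the vertices, the edges `e` and the
ghost edges `e*`. -/
inductive LeavittGen (V : Type u) (E : Type v) : Type (max u v)
  | vertex (x : V)
  | edge (e : E)
  | ghost (e : E)

namespace LeavittPath

/-- The free (associative, not necessarily unital) `K`-algebra on the generators: formal
`K`-linear combinations of nonempty words. -/
abbrev FreeAlg (K : Type w) [Field K] (V : Type u) (E : Type v) : Type (max u v w) :=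
  MonoidAlgebra K (FreeSemigroup (LeavittGen V E))

variable (K : Type w) [Field K] {V : Type u} {E : Type v}

/-- A word, as an element of the free algebra. -/
noncomputable def freeWord (m : FreeSemigroup (LeavittGen V E)) : FreeAlg K V E :=
  MonoidAlgebra.single m 1

/-- A generator, as an element of the free algebra. -/
noncomputable def freeGen (a : LeavittGen V E) : FreeAlg K V E :=
  freeWord K (FreeSemigroup.of a)

open LeavittGen in
/-- The defining relations of the Leavitt path algebra. -/
inductive Rel (G : DirectedGraph V E) : FreeAlg K V E → FreeAlg K V E → Prop
  | vertex_self (x : V) :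
      Rel G (freeGen K (vertex x) * freeGen K (vertex x)) (freeGen K (vertex x))
  | vertex_ne (x y : V) (h : x ≠ y) :
      Rel G (freeGen K (vertex x) * freeGen K (vertex y)) 0
  | src_edge (e : E) :
      Rel G (freeGen K (vertex (G.src e)) * freeGen K (edge e)) (freeGen K (edge e))
  | edge_rng (e : E) :
      Rel G (freeGen K (edge e) * freeGen K (vertex (G.rng e))) (freeGen K (edge e))
  | rng_ghost (e : E) :
      Rel G (freeGen K (vertex (G.rng e)) * freeGen K (ghost e)) (freeGen K (ghost e))
  | ghost_src (e : E) :
      Rel G (freeGen K (ghost e) * freeGen K (vertex (G.src e))) (freeGen K (ghost e))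
  | ghost_edge_self (e : E) :
      Rel G (freeGen K (ghost e) * freeGen K (edge e)) (freeGen K (vertex (G.rng e)))
  | ghost_edge_ne (e f : E) (h : e ≠ f) :
      Rel G (freeGen K (ghost e) * freeGen K (edge f)) 0
  | vertex_sum (x : V) (hne : (G.emitted x).Nonempty) (hfin : (G.emitted x).Finite) :
      Rel G (freeGen K (vertex x))
        (∑ e ∈ hfin.toFinset, freeGen K (edge e) * freeGen K (ghost e))

/-- The `K`-algebra congruence generated by the defining relations. The free algebra has no unit,
so closing under scalar multiplication has to be asked for: all scalar multiples of the defining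
relations are imposed. -/
noncomputable def con (G : DirectedGraph V E) : RingCon (FreeAlg K V E) :=
  ringConGen (fun a b => ∃ (k : K) (a' b' : FreeAlg K V E), Rel K G a' b' ∧
    a = k • a' ∧ b = k • b')

theorem con_smul (G : DirectedGraph V E) (k : K) {a b : FreeAlg K V E} (h : con K G a b) :
    con K G (k • a) (k • b) := by
  change RingConGen.Rel _ a b at h
  change RingConGen.Rel _ (k • a) (k • b)
  induction h with
  | of x y h =>
    obtain ⟨l, a', b', h, rfl, rfl⟩ := h
    exact .of _ _ ⟨k * l, a', b', h, (mul_smul _ _ _).symm, (mul_smul _ _ _).symm⟩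
  | refl x => exact .refl _
  | symm _ ih => exact .symm ih
  | trans _ _ ih₁ ih₂ => exact .trans ih₁ ih₂
  | add _ _ ih₁ ih₂ => rw [smul_add, smul_add]; exact .add ih₁ ih₂
  | mul _ h₂ ih₁ _ => rw [← smul_mul_assoc, ← smul_mul_assoc]; exact .mul ih₁ h₂

end LeavittPath

/-- The Leavitt path algebra `L_K(G)`: the associative, not necessarily unital `K`-algebra
generated by the vertices, edges and ghost edges subject to the defining relations. -/
def LeavittPathAlgebra (K : Type w) [Field K] {V : Type u} {E : Type v}
    (G : DirectedGraph V E) : Type (max u v w) :=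
  (LeavittPath.con K G).Quotient

namespace LeavittPathAlgebra

variable (K : Type w) [Field K] {V : Type u} {E : Type v} (G : DirectedGraph V E)

noncomputable instance : NonUnitalRing (LeavittPathAlgebra K G) :=
  inferInstanceAs (NonUnitalRing (LeavittPath.con K G).Quotient)

/-- The quotient map from the free algebra. -/
noncomputable def mk : LeavittPath.FreeAlg K V E →ₙ+* LeavittPathAlgebra K G where
  toFun a := ((a : (LeavittPath.con K G).Quotient))
  map_mul' _ _ := rfl
  map_zero' := rfl
  map_add' _ _ := rfl

theorem mk_surjective : Function.Surjective (mk K G) := Quotient.mk_surjective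

noncomputable instance : SMul K (LeavittPathAlgebra K G) where
  smul k := Quotient.map (fun a => k • a) (fun _ _ h => LeavittPath.con_smul K G k h)

theorem smul_mk (k : K) (a : LeavittPath.FreeAlg K V E) :
    k • mk K G a = mk K G (k • a) := rfl

noncomputable instance : Module K (LeavittPathAlgebra K G) :=
  Function.Surjective.module K (mk K G).toAddMonoidHom (mk_surjective K G) (fun _ _ => rfl)

instance : IsScalarTower K (LeavittPathAlgebra K G) (LeavittPathAlgebra K G) where
  smul_assoc k a b := by
    obtain ⟨a, rfl⟩ := mk_surjective K G a
    obtain ⟨b, rfl⟩ := mk_surjective K G b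
    simp only [smul_eq_mul, smul_mk, ← map_mul, smul_mul_assoc]

instance : SMulCommClass K (LeavittPathAlgebra K G) (LeavittPathAlgebra K G) where
  smul_comm k a b := by
    obtain ⟨a, rfl⟩ := mk_surjective K G a
    obtain ⟨b, rfl⟩ := mk_surjective K G b
    simp only [smul_eq_mul, smul_mk, ← map_mul, mul_smul_comm]

/-- The degree of a generator: vertices have degree `0`, edges `1`, ghost edges `-1`. -/
def genDegree : LeavittGen V E → ℤ
  | .vertex _ => 0
  | .edge _ => 1
  | .ghost _ => -1

/-- The degree of a word is the sum of the degrees of its letters. -/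
def wordDegree (m : FreeSemigroup (LeavittGen V E)) : ℤ :=
  genDegree m.head + (m.tail.map genDegree).sum

/-- The homogeneous component of degree `n` in the canonical `ℤ`-grading of `L_K(G)`: the
`K`-span of the monomials of degree `n`. -/
noncomputable def component (n : ℤ) : Submodule K (LeavittPathAlgebra K G) :=
  Submodule.span K
    {a | ∃ m : FreeSemigroup (LeavittGen V E),
      wordDegree m = n ∧ a = mk K G (LeavittPath.freeWord K m)}

variable {K G}

/-- A two-sided ideal `I` is graded if `I` is the sum of the `I ∩ L_n`, `n ∈ ℤ`: every element
of `I` is a finite sum of homogeneous elements that lie in `I`. -/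
def IsGradedIdeal (I : TwoSidedIdeal (LeavittPathAlgebra K G)) : Prop :=
  ∀ a ∈ I, ∃ c : ℤ →₀ LeavittPathAlgebra K G,
    (∀ n : ℤ, c n ∈ I ∧ c n ∈ component K G n) ∧ a = c.sum (fun _ b => b)

end LeavittPathAlgebra

/-- The ascending chain condition: every ascending chain `a 0 ≤ a 1 ≤ ...` becomes stationary. -/
def SatisfiesACC (α : Type u) [PartialOrder α] : Prop :=
  ∀ a : ℕ → α, (∀ i, a i ≤ a (i + 1)) → ∃ n : ℕ, ∀ i, n ≤ i → a i = a n

/-!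
The map `H ↦ I(H)`, which sends a hereditary saturated set to the two-sided ideal generated by its
vertices, and the map `I ↦ I ∩ E⁰` link the ideals of `L_K(G)` with the hereditary saturated sets.

The ideal `I(H)` is graded, and `I(H) ∩ E⁰ = H` (`vertexSet_vertexIdeal`), since `L_K(G)` has a
representation in which a vertex acts as zero exactly if it lies in `H` (`exists_representation`).
So chains of hereditary saturated sets embed into chains of graded ideals.

Conversely, an ideal is in general not determined by `H = I ∩ E⁰`. What is missing lives at the
vertices `x ∉ H` on a cycle without exits outside of `H` (`DirectedGraph.IsExitFree`): by
`le_of_vertexSet_of_closedSpan`, `I` is determined by `H` together with the combinations of closed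
paths at such `x` that lie in `I`. To see this, multiply an element of `I` by edges on the right to
remove the ghost edges, and split a combination of real paths along a shortest path. There remains
a combination `k x + ∑ kᵢ qᵢ` with `k ≠ 0` and nontrivial closed paths `qᵢ` at `x`. If `x ∉ H` is
not exit-free, there is a path `τ` from `x`, ending at some `y ∉ H`, that is not an initial segment
of any `qᵢ τ`; then `τ* (k x + ∑ kᵢ qᵢ) τ = k y` puts `y` into `H`, a contradiction. The path `τ`
exists because two long words which differ in the last letter only cannot both be periodic
(`DirectedGraph.exists_aperiodic`).

At an exit-free vertex all closed paths are powers of one of them, so the combinations of closed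
paths form a quotient of the noetherian ring `K[X]` (`exists_closedSpan_stable`). The ascending
chain condition on hereditary saturated sets makes the sets `I ∩ E⁰` of a chain of ideals
stationary, and it leaves only finitely many exit-free vertices up to mutual reachability
(`DirectedGraph.exists_finset_exitFree`). Mutually reachable exit-free vertices carry the same
information (`closedSpan_transport`), so the whole chain becomes stationary.
-/

/-! ### Paths -/

namespace DirectedGraph

variable {V : Type u} {E : Type v} (G : DirectedGraph V E)

/-- `G.IsPath x l y`: the list of edges `l` is a path from `x` to `y`; the empty list is the
trivial path. -/
def IsPath : V → List E → V → Prop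
  | x, [], y => x = y
  | x, e :: l, y => G.src e = x ∧ IsPath (G.rng e) l y

variable {G}

theorem IsPath.append {x y z : V} {l l' : List E} (h : G.IsPath x l y) (h' : G.IsPath y l' z) :
    G.IsPath x (l ++ l') z := by
  induction l generalizing x with
  | nil => cases h; exact h'
  | cons e l ih => exact ⟨h.1, ih h.2⟩

theorem IsPath.drop_append {x y z : V} {l l' : List E} (h : G.IsPath x l y)
    (h' : G.IsPath x (l ++ l') z) : G.IsPath y l' z := by
  induction l generalizing x with
  | nil => cases h; exact h'
  | cons e l ih => exact ih h.2 h'.2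

theorem reaches_iff_exists_isPath {x y : V} : G.Reaches x y ↔ ∃ l, G.IsPath x l y := by
  constructor
  · intro h
    induction h using Relation.ReflTransGen.head_induction_on with
    | refl => exact ⟨[], rfl⟩
    | head h _ ih =>
      obtain ⟨e, rfl, rfl⟩ := h
      obtain ⟨l, hl⟩ := ih
      exact ⟨e :: l, rfl, hl⟩
  · rintro ⟨l, hl⟩
    induction l generalizing x with
    | nil => cases hl; exact .refl
    | cons e l ih => exact .head ⟨e, hl.1, rfl⟩ (ih hl.2)

theorem IsPath.reaches {x y : V} {l : List E} (h : G.IsPath x l y) : G.Reaches x y :=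
  reaches_iff_exists_isPath.2 ⟨l, h⟩

/-- A vertex on a nontrivial closed path admits closed paths of arbitrarily large length. -/
theorem exists_long_closed {x : V} {l : List E} (h : G.IsPath x l x) (hl : l ≠ []) (n : ℕ) :
    ∃ q, G.IsPath x q x ∧ n ≤ q.length := by
  induction n with
  | zero => exact ⟨l, h, Nat.zero_le _⟩
  | succ n ih =>
    obtain ⟨q, hq, hn⟩ := ih
    refine ⟨l ++ q, h.append hq, ?_⟩
    have := List.length_pos_iff.2 hl
    simp only [List.length_append]
    omega

/-! ### Hereditary saturated sets -/

theorem subset_hsClosure (X : Set V) : X ⊆ G.hsClosure X :=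
  Set.subset_sInter fun _ h => h.1

theorem hsClosure_subset {X H : Set V} (h : X ⊆ H) (hh : G.IsHereditary H)
    (hs : G.IsSaturated H) : G.hsClosure X ⊆ H :=
  Set.sInter_subset_of_mem ⟨h, hh, hs⟩

theorem isHereditary_hsClosure (X : Set V) : G.IsHereditary (G.hsClosure X) :=
  fun x y hx hxy H hH => hH.2.1 x y (hx H hH) hxy

theorem isSaturated_hsClosure (X : Set V) : G.IsSaturated (G.hsClosure X) :=
  fun x hne hfin h H hH => hH.2.2 x hne hfin fun _ hy => h hy H hH

theorem hsClosure_eq_self {H : Set V} (hh : G.IsHereditary H) (hs : G.IsSaturated H) :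
    G.hsClosure H = H :=
  (hsClosure_subset subset_rfl hh hs).antisymm (subset_hsClosure H)

end DirectedGraph

/-! ### Generators of the Leavitt path algebra -/

namespace LeavittPathAlgebra

open LeavittPath DirectedGraph

variable (K : Type w) [Field K] {V : Type u} {E : Type v} (G : DirectedGraph V E)

/-- The class of a vertex in `L_K(G)`. -/
noncomputable def vtx (x : V) : LeavittPathAlgebra K G := mk K G (freeGen K (.vertex x))

/-- The class of an edge in `L_K(G)`. -/
noncomputable def edge (e : E) : LeavittPathAlgebra K G := mk K G (freeGen K (.edge e))

/-- The class of a ghost edge in `L_K(G)`. -/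
noncomputable def ghost (e : E) : LeavittPathAlgebra K G := mk K G (freeGen K (.ghost e))

variable {K G}

theorem mk_eq_of_rel {a b : FreeAlg K V E} (h : Rel K G a b) : mk K G a = mk K G b :=
  (RingCon.eq _).2 (RingConGen.Rel.of _ _ ⟨1, a, b, h, (one_smul _ _).symm, (one_smul _ _).symm⟩)

theorem vtx_mul_self (x : V) : vtx K G x * vtx K G x = vtx K G x := by
  simpa only [vtx, map_mul] using mk_eq_of_rel (Rel.vertex_self (G := G) (K := K) x)

theorem vtx_mul_of_ne {x y : V} (h : x ≠ y) : vtx K G x * vtx K G y = 0 := by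
  simpa only [vtx, map_mul, map_zero] using mk_eq_of_rel (Rel.vertex_ne (G := G) (K := K) x y h)

theorem vtx_src_mul_edge (e : E) : vtx K G (G.src e) * edge K G e = edge K G e := by
  simpa only [vtx, edge, map_mul] using mk_eq_of_rel (Rel.src_edge (G := G) (K := K) e)

theorem edge_mul_vtx_rng (e : E) : edge K G e * vtx K G (G.rng e) = edge K G e := by
  simpa only [vtx, edge, map_mul] using mk_eq_of_rel (Rel.edge_rng (G := G) (K := K) e)

theorem vtx_rng_mul_ghost (e : E) : vtx K G (G.rng e) * ghost K G e = ghost K G e := by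
  simpa only [vtx, ghost, map_mul] using mk_eq_of_rel (Rel.rng_ghost (G := G) (K := K) e)

theorem ghost_mul_vtx_src (e : E) : ghost K G e * vtx K G (G.src e) = ghost K G e := by
  simpa only [vtx, ghost, map_mul] using mk_eq_of_rel (Rel.ghost_src (G := G) (K := K) e)

theorem ghost_mul_edge_self (e : E) : ghost K G e * edge K G e = vtx K G (G.rng e) := by
  simpa only [vtx, edge, ghost, map_mul] using
    mk_eq_of_rel (Rel.ghost_edge_self (G := G) (K := K) e)

theorem ghost_mul_edge_of_ne {e f : E} (h : e ≠ f) : ghost K G e * edge K G f = 0 := by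
  simpa only [edge, ghost, map_mul, map_zero] using
    mk_eq_of_rel (Rel.ghost_edge_ne (G := G) (K := K) e f h)

theorem vtx_eq_sum {x : V} (hne : (G.emitted x).Nonempty) (hfin : (G.emitted x).Finite) :
    vtx K G x = ∑ e ∈ hfin.toFinset, edge K G e * ghost K G e := by
  simpa only [vtx, edge, ghost, map_mul, map_sum] using
    mk_eq_of_rel (Rel.vertex_sum (G := G) (K := K) x hne hfin)

theorem vtx_mul_edge_of_ne {x : V} {e : E} (h : x ≠ G.src e) : vtx K G x * edge K G e = 0 := by
  rw [← vtx_src_mul_edge, ← mul_assoc, vtx_mul_of_ne h, zero_mul]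

theorem ghost_mul_vtx_of_ne {x : V} {e : E} (h : G.src e ≠ x) : ghost K G e * vtx K G x = 0 := by
  rw [← ghost_mul_vtx_src, mul_assoc, vtx_mul_of_ne h, mul_zero]

theorem mk_freeWord_mul (m m' : FreeSemigroup (LeavittGen V E)) :
    mk K G (freeWord K (m * m')) = mk K G (freeWord K m) * mk K G (freeWord K m') := by
  simp [freeWord, ← map_mul, MonoidAlgebra.single_mul_single]

theorem mem_span_words (a : LeavittPathAlgebra K G) :
    a ∈ Submodule.span K (Set.range fun m => mk K G (freeWord K m)) := by
  obtain ⟨a, rfl⟩ := mk_surjective K G a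
  induction a using MonoidAlgebra.induction_linear with
  | zero => rw [map_zero]; exact Submodule.zero_mem _
  | add a b ha hb => rw [map_add]; exact Submodule.add_mem _ ha hb
  | single m k =>
    have : (MonoidAlgebra.single m k : FreeAlg K V E) = k • freeWord K m := by
      simp [freeWord]
    rw [this, ← smul_mk]
    exact Submodule.smul_mem _ k (Submodule.subset_span ⟨m, rfl⟩)

/-! ### Real and ghost paths in the algebra -/

variable (K G)

/-- The element `e₁ e₂ ⋯ eₙ y` of `L_K(G)` for a list of edges `e₁, …, eₙ`. It is `0` when the
list is not a path ending at `y`. -/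
noncomputable def pathElt : List E → V → LeavittPathAlgebra K G
  | [], y => vtx K G y
  | e :: l, y => edge K G e * pathElt l y

/-- The element `y eₙ* ⋯ e₁*` of `L_K(G)` for a list of edges `e₁, …, eₙ`. -/
noncomputable def ghostElt : List E → V → LeavittPathAlgebra K G
  | [], y => vtx K G y
  | e :: l, y => ghostElt l y * ghost K G e

variable {K G}

theorem pathElt_mul_vtx (l : List E) (y : V) :
    pathElt K G l y * vtx K G y = pathElt K G l y := by
  induction l with
  | nil => exact vtx_mul_self y
  | cons e l ih => rw [pathElt, mul_assoc, ih]

theorem vtx_mul_pathElt {x y : V} {l : List E} (h : G.IsPath x l y) :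
    vtx K G x * pathElt K G l y = pathElt K G l y := by
  cases l with
  | nil => cases h; exact vtx_mul_self _
  | cons e l => rw [pathElt, ← mul_assoc, ← h.1, vtx_src_mul_edge]

theorem vtx_mul_pathElt_of_not {x y : V} {l : List E} (h : ¬ G.IsPath x l y) :
    vtx K G x * pathElt K G l y = 0 := by
  induction l generalizing x with
  | nil => exact vtx_mul_of_ne h
  | cons e l ih =>
    rw [pathElt, ← mul_assoc]
    by_cases he : G.src e = x
    · rw [← he, vtx_src_mul_edge, ← edge_mul_vtx_rng, mul_assoc, ih fun h' => h ⟨he, h'⟩, mul_zero]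
    · rw [vtx_mul_edge_of_ne (Ne.symm he), zero_mul]

theorem pathElt_eq_zero {y : V} {l : List E} (h : ∀ x, ¬ G.IsPath x l y) :
    pathElt K G l y = 0 := by
  cases l with
  | nil => exact absurd rfl (h y)
  | cons e l =>
    rw [pathElt, ← vtx_src_mul_edge, mul_assoc]
    exact vtx_mul_pathElt_of_not (h _)

theorem pathElt_mul_pathElt {x y : V} {l : List E} (l' : List E) (h : G.IsPath x l y) :
    pathElt K G l' x * pathElt K G l y = pathElt K G (l' ++ l) y := by
  induction l' with
  | nil => exact vtx_mul_pathElt h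
  | cons e l' ih => rw [pathElt, mul_assoc, ih, List.cons_append, pathElt]

theorem ghostElt_mul_vtx {x y : V} {l : List E} (h : G.IsPath x l y) :
    ghostElt K G l y * vtx K G x = ghostElt K G l y := by
  cases l with
  | nil => cases h; exact vtx_mul_self _
  | cons e l => rw [ghostElt, mul_assoc, ← h.1, ghost_mul_vtx_src]

theorem ghostElt_mul_vtx_or (β : List E) (y x : V) :
    ghostElt K G β y * vtx K G x = ghostElt K G β y ∨ ghostElt K G β y * vtx K G x = 0 := by
  cases β with
  | nil =>
    by_cases hy : y = x
    · subst hy; exact .inl (vtx_mul_self _)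
    · exact .inr (vtx_mul_of_ne hy)
  | cons f β =>
    rw [ghostElt, mul_assoc]
    by_cases hf : G.src f = x
    · subst hf; rw [ghost_mul_vtx_src]; exact .inl rfl
    · rw [ghost_mul_vtx_of_ne hf, mul_zero]; exact .inr rfl

theorem ghostElt_mul_pathElt_append {x y : V} {l : List E} (h : G.IsPath x l y) (l' : List E)
    (z : V) : ghostElt K G l y * pathElt K G (l ++ l') z = vtx K G y * pathElt K G l' z := by
  induction l generalizing x with
  | nil => rfl
  | cons e l ih =>
    rw [ghostElt, List.cons_append, pathElt, mul_assoc, ← mul_assoc (ghost K G e),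
      ghost_mul_edge_self, ← mul_assoc, ghostElt_mul_vtx h.2, ih h.2]

theorem ghostElt_mul_pathElt_self {x y : V} {l : List E} (h : G.IsPath x l y) :
    ghostElt K G l y * pathElt K G l y = vtx K G y := by
  simpa only [List.append_nil, pathElt, vtx_mul_self] using
    ghostElt_mul_pathElt_append (K := K) h [] y

/-- Two paths, the first not longer than the second and not an initial segment of it, are
orthogonal. -/
theorem ghostElt_mul_pathElt_eq_zero {l l' : List E} (h : ¬ l <+: l') (hl : l.length ≤ l'.length)
    (y z : V) : ghostElt K G l y * pathElt K G l' z = 0 := by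
  induction l generalizing l' with
  | nil => exact absurd List.nil_prefix h
  | cons e l ih =>
    cases l' with
    | nil => simp at hl
    | cons f l' =>
      rw [ghostElt, pathElt, mul_assoc, ← mul_assoc (ghost K G e)]
      by_cases hef : e = f
      · subst hef
        rw [ghost_mul_edge_self]
        by_cases hp : G.IsPath (G.rng e) l' z
        · rw [vtx_mul_pathElt hp]
          exact ih (fun h' => h (by simpa using h')) (by simpa using hl)
        · rw [vtx_mul_pathElt_of_not hp, mul_zero]
      · rw [ghost_mul_edge_of_ne hef, zero_mul, mul_zero]

/-! ### Spanning monomials and local units -/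

variable (K G) in
/-- The span of the monomials `α β*` with `α`, `β` paths with a common end and `β` of length at
most `m`. -/
noncomputable def monomialSpan (m : ℕ) : Submodule K (LeavittPathAlgebra K G) :=
  Submodule.span K {a | ∃ (α β : List E) (y : V), β.length ≤ m ∧
    a = pathElt K G α y * ghostElt K G β y}

theorem monomial_mem {α β : List E} {m : ℕ} (h : β.length ≤ m) (y : V) :
    pathElt K G α y * ghostElt K G β y ∈ monomialSpan K G m :=
  Submodule.subset_span ⟨α, β, y, h, rfl⟩

theorem monomialSpan_mono : Monotone (monomialSpan K G) := fun _ _ hmn =>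
  Submodule.span_mono fun _ ⟨α, β, y, h, ha⟩ => ⟨α, β, y, h.trans hmn, ha⟩

theorem pathElt_mem (l : List E) (y : V) (m : ℕ) : pathElt K G l y ∈ monomialSpan K G m := by
  rw [← pathElt_mul_vtx]
  exact monomial_mem (β := []) (Nat.zero_le _) y

theorem pathElt_mul_edge_mem (α : List E) (y : V) (e : E) (m : ℕ) :
    pathElt K G α y * edge K G e ∈ monomialSpan K G m := by
  by_cases h : y = G.src e
  · have : pathElt K G [e] (G.rng e) = edge K G e := edge_mul_vtx_rng e
    rw [← this, pathElt_mul_pathElt α (show G.IsPath y [e] (G.rng e) from ⟨h.symm, rfl⟩)]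
    exact pathElt_mem _ _ _
  · rw [← pathElt_mul_vtx, mul_assoc, vtx_mul_edge_of_ne h, mul_zero]
    exact Submodule.zero_mem _

/-- Right multiplication by an edge cancels a ghost edge. -/
theorem mul_edge_mem {m : ℕ} {a : LeavittPathAlgebra K G} (ha : a ∈ monomialSpan K G (m + 1))
    (e : E) : a * edge K G e ∈ monomialSpan K G m := by
  induction ha using Submodule.span_induction with
  | zero => rw [zero_mul]; exact Submodule.zero_mem _
  | add a b _ _ ha hb => rw [add_mul]; exact Submodule.add_mem _ ha hb
  | smul k a _ ha => rw [smul_mul_assoc]; exact Submodule.smul_mem _ k ha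
  | mem a ha =>
    obtain ⟨α, β, y, hβ, rfl⟩ := ha
    cases β with
    | nil => rw [ghostElt, pathElt_mul_vtx]; exact pathElt_mul_edge_mem _ _ _ _
    | cons f β =>
      rw [ghostElt, mul_assoc, mul_assoc]
      by_cases hf : f = e
      · subst hf
        rw [ghost_mul_edge_self]
        rcases ghostElt_mul_vtx_or (K := K) β y (G.rng f) with h | h <;> rw [h]
        · exact monomial_mem (by simpa using hβ) y
        · rw [mul_zero]; exact Submodule.zero_mem _
      · rw [ghost_mul_edge_of_ne hf, mul_zero, mul_zero]; exact Submodule.zero_mem _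

/-- Right multiplication by a vertex keeps or kills every monomial; at a sink only the monomials
without ghost edges survive. -/
theorem mul_vtx_mem {m : ℕ} {a : LeavittPathAlgebra K G} (ha : a ∈ monomialSpan K G m) {x : V}
    (hx : m = 0 ∨ G.emitted x = ∅) :
    a * vtx K G x ∈ Submodule.span K (Set.range fun l => pathElt K G l x) := by
  induction ha using Submodule.span_induction with
  | zero => rw [zero_mul]; exact Submodule.zero_mem _
  | add a b _ _ ha hb => rw [add_mul]; exact Submodule.add_mem _ ha hb
  | smul k a _ ha => rw [smul_mul_assoc]; exact Submodule.smul_mem _ k ha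
  | mem a ha =>
    obtain ⟨α, β, y, hβ, rfl⟩ := ha
    cases β with
    | nil =>
      rw [ghostElt, pathElt_mul_vtx]
      by_cases hy : y = x
      · subst hy
        rw [pathElt_mul_vtx]
        exact Submodule.subset_span ⟨α, rfl⟩
      · rw [← pathElt_mul_vtx, mul_assoc, vtx_mul_of_ne hy, mul_zero]
        exact Submodule.zero_mem _
    | cons f β =>
      rcases hx with rfl | hx
      · simp at hβ
      · have hf : G.src f ≠ x := fun hf => by
          have : f ∈ G.emitted x := hf
          simp [hx] at this
        rw [ghostElt, mul_assoc, mul_assoc, ghost_mul_vtx_of_ne hf, mul_zero, mul_zero]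
        exact Submodule.zero_mem _

variable (K G) in
/-- The span of all monomials `α β*`. -/
noncomputable def allMonomials : Submodule K (LeavittPathAlgebra K G) :=
  ⨆ m, monomialSpan K G m

theorem mem_allMonomials {a : LeavittPathAlgebra K G} :
    a ∈ allMonomials K G ↔ ∃ m, a ∈ monomialSpan K G m :=
  Submodule.mem_iSup_of_directed _ monomialSpan_mono.directed_le

theorem mul_vtx_mem_monomialSpan {m : ℕ} {a : LeavittPathAlgebra K G}
    (ha : a ∈ monomialSpan K G m) (x : V) : a * vtx K G x ∈ monomialSpan K G m := by
  induction ha using Submodule.span_induction with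
  | zero => rw [zero_mul]; exact Submodule.zero_mem _
  | add a b _ _ ha hb => rw [add_mul]; exact Submodule.add_mem _ ha hb
  | smul k a _ ha => rw [smul_mul_assoc]; exact Submodule.smul_mem _ k ha
  | mem a ha =>
    obtain ⟨α, β, y, hβ, rfl⟩ := ha
    rw [mul_assoc]
    rcases ghostElt_mul_vtx_or (K := K) β y x with h | h <;> rw [h]
    · exact monomial_mem hβ y
    · rw [mul_zero]; exact Submodule.zero_mem _

theorem mul_ghost_mem {m : ℕ} {a : LeavittPathAlgebra K G} (ha : a ∈ monomialSpan K G m) (e : E) :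
    a * ghost K G e ∈ monomialSpan K G (m + 1) := by
  induction ha using Submodule.span_induction with
  | zero => rw [zero_mul]; exact Submodule.zero_mem _
  | add a b _ _ ha hb => rw [add_mul]; exact Submodule.add_mem _ ha hb
  | smul k a _ ha => rw [smul_mul_assoc]; exact Submodule.smul_mem _ k ha
  | mem a ha =>
    obtain ⟨α, β, y, hβ, rfl⟩ := ha
    rw [mul_assoc]
    exact monomial_mem (β := e :: β) (by simpa using hβ) y

/-- Induction on the length of words: a subspace containing the generators and closed under right
multiplication by generators is everything. -/
theorem eq_top_of_mul_gen_mem (N : Submodule K (LeavittPathAlgebra K G))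
    (h1 : ∀ g, mk K G (freeGen K g) ∈ N)
    (h2 : ∀ a ∈ N, ∀ g, a * mk K G (freeGen K g) ∈ N) : N = ⊤ := by
  have key (m : FreeSemigroup (LeavittGen V E)) : ∀ a ∈ N, a * mk K G (freeWord K m) ∈ N := by
    induction m using FreeSemigroup.recOnMul with
    | ih1 g => exact fun a ha => h2 a ha g
    | ih2 g m _ ih =>
      intro a ha
      rw [mk_freeWord_mul, ← mul_assoc]
      exact ih _ (h2 a ha g)
  have word (m : FreeSemigroup (LeavittGen V E)) : mk K G (freeWord K m) ∈ N := by
    induction m using FreeSemigroup.recOnMul with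
    | ih1 g => exact h1 g
    | ih2 g m _ _ =>
      rw [mk_freeWord_mul]
      exact key m _ (h1 g)
  rw [eq_top_iff]
  rintro a -
  refine Submodule.span_le.2 ?_ (mem_span_words a)
  rintro _ ⟨m, rfl⟩
  exact word m

theorem exists_mem_monomialSpan (a : LeavittPathAlgebra K G) : ∃ m, a ∈ monomialSpan K G m := by
  rw [← mem_allMonomials, eq_top_of_mul_gen_mem (allMonomials K G)]
  · trivial
  · rintro (x | e | e) <;> rw [mem_allMonomials]
    · exact ⟨0, pathElt_mem [] x 0⟩
    · refine ⟨0, ?_⟩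
      change edge K G e ∈ _
      rw [← edge_mul_vtx_rng]
      exact pathElt_mem [e] _ 0
    · refine ⟨1, ?_⟩
      change ghost K G e ∈ _
      rw [← vtx_rng_mul_ghost]
      exact mul_ghost_mem (pathElt_mem [] _ 0) e
  · simp only [mem_allMonomials]
    rintro a ⟨m, ha⟩ (x | e | e)
    · exact ⟨m, mul_vtx_mem_monomialSpan ha x⟩
    · exact ⟨m, mul_edge_mem (monomialSpan_mono m.le_succ ha) e⟩
    · exact ⟨m + 1, mul_ghost_mem ha e⟩

/-- Finite sums of vertices are local right units. -/
theorem exists_eq_sum_mul_vtx (a : LeavittPathAlgebra K G) :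
    ∃ F : Finset V, ∀ F', F ⊆ F' → a = ∑ x ∈ F', a * vtx K G x := by
  classical
  obtain ⟨m, ha⟩ := exists_mem_monomialSpan a
  have of_vtx {b : LeavittPathAlgebra K G} {x : V} (hb : b * vtx K G x = b) :
      ∃ F : Finset V, ∀ F', F ⊆ F' → b = ∑ y ∈ F', b * vtx K G y := by
    refine ⟨{x}, fun F' hF' => ?_⟩
    rw [Finset.sum_eq_single_of_mem x (hF' (Finset.mem_singleton_self x)), hb]
    intro y _ hy
    rw [← hb, mul_assoc, vtx_mul_of_ne hy.symm, mul_zero]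
  induction ha using Submodule.span_induction with
  | zero => exact ⟨∅, by simp⟩
  | add a b _ _ ha hb =>
    obtain ⟨F₁, h₁⟩ := ha
    obtain ⟨F₂, h₂⟩ := hb
    refine ⟨F₁ ∪ F₂, fun F' hF' => ?_⟩
    simp only [add_mul, Finset.sum_add_distrib]
    rw [← h₁ F' (Finset.union_subset_left hF'), ← h₂ F' (Finset.union_subset_right hF')]
  | smul k a _ ha =>
    obtain ⟨F, h⟩ := ha
    refine ⟨F, fun F' hF' => ?_⟩
    simp only [smul_mul_assoc, ← Finset.smul_sum]
    rw [← h F' hF']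
  | mem a ha =>
    obtain ⟨α, β, y, hβ, rfl⟩ := ha
    cases β with
    | nil => exact of_vtx (x := y) (by rw [ghostElt, mul_assoc, vtx_mul_self])
    | cons f β =>
      exact of_vtx (x := G.src f) (by rw [ghostElt, mul_assoc, mul_assoc, ghost_mul_vtx_src])

/-- Because of the local units, two-sided ideals are closed under scalars. -/
theorem smul_mem (I : TwoSidedIdeal (LeavittPathAlgebra K G)) (k : K)
    {a : LeavittPathAlgebra K G} (ha : a ∈ I) : k • a ∈ I := by
  obtain ⟨F, hF⟩ := exists_eq_sum_mul_vtx a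
  have : k • a = a * k • ∑ x ∈ F, vtx K G x := by
    rw [mul_smul_comm, Finset.mul_sum, ← hF F subset_rfl]
  rw [this]
  exact I.mul_mem_right _ _ ha

/-- A two-sided ideal of `L_K(G)` as a `K`-subspace. -/
noncomputable def toSubmodule (I : TwoSidedIdeal (LeavittPathAlgebra K G)) :
    Submodule K (LeavittPathAlgebra K G) where
  carrier := I
  add_mem' := I.add_mem
  zero_mem' := I.zero_mem
  smul_mem' k _ ha := smul_mem I k ha

theorem mem_toSubmodule {I : TwoSidedIdeal (LeavittPathAlgebra K G)}
    {a : LeavittPathAlgebra K G} : a ∈ toSubmodule I ↔ a ∈ I := Iff.rfl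

end LeavittPathAlgebra

/-! ### Exit-free closed paths and aperiodic words -/

namespace DirectedGraph

variable {V : Type u} {E : Type v} {G : DirectedGraph V E}

/-- A list `τ` which is an initial segment of `l ++ τ` has period `|l|`. -/
theorem getElem?_add_mul_of_prefix {l τ : List E} (h : τ <+: l ++ τ) (t k : ℕ)
    (hk : t + k * l.length < τ.length) : τ[t + k * l.length]? = τ[t]? := by
  induction k with
  | zero => simp
  | succ k ih =>
    have hk' : t + k * l.length + l.length < τ.length := by rwa [add_assoc, ← Nat.succ_mul]
    rw [← ih (by omega), Nat.succ_mul, ← add_assoc, List.getElem?_eq_getElem hk',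
      ← List.prefix_iff_getElem?.1 h _ hk', List.getElem?_append_right (by omega),
      Nat.add_sub_cancel]

/-- Two words which differ in the last letter only cannot both be periodic, if they are long
enough. -/
theorem eq_of_prefix_of_prefix {ρ l₁ l₂ : List E} {f g : E}
    (h₁ : ρ ++ [f] <+: l₁ ++ (ρ ++ [f])) (h₂ : ρ ++ [g] <+: l₂ ++ (ρ ++ [g]))
    (hl₁ : l₁ ≠ []) (hl₂ : l₂ ≠ []) (hρ : l₁.length * l₂.length ≤ ρ.length) : f = g := by
  have hpos : 0 < l₁.length * l₂.length :=
    Nat.mul_pos (List.length_pos_iff.2 hl₁) (List.length_pos_iff.2 hl₂)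
  obtain ⟨t, ht⟩ := Nat.exists_eq_add_of_le' hρ
  have e₁ := getElem?_add_mul_of_prefix h₁ t l₂.length
    (by rw [List.length_append, ht, mul_comm]; simp)
  have e₂ := getElem?_add_mul_of_prefix h₂ t l₁.length
    (by rw [List.length_append, ht]; simp)
  have htρ : t < ρ.length := by omega
  rw [mul_comm, ← ht, List.getElem?_append_right le_rfl, List.getElem?_append_left htρ] at e₁
  rw [← ht, List.getElem?_append_right le_rfl, List.getElem?_append_left htρ] at e₂
  rw [← e₁] at e₂
  simpa using e₂.symm

variable (G) in
/-- The vertex `x` lies on a cycle which has no exit outside of `H`: there is a nontrivial closed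
path at `x`, and a vertex which `x` reaches emits at most one edge that ends outside of `H`. -/
def IsExitFree (H : Set V) (x : V) : Prop :=
  x ∉ H ∧ (∃ l, l ≠ [] ∧ G.IsPath x l x) ∧ ∀ e f, G.Reaches x (G.src e) → G.src e = G.src f →
    G.rng e ∉ H → G.rng f ∉ H → e = f

/-- At a vertex that is not exit-free there is a path, ending outside of `H`, which is not periodic
with any of finitely many given closed paths as a period. -/
theorem exists_aperiodic {H : Set V} {x : V} (hx : x ∉ H) (hex : ¬ G.IsExitFree H x)
    (s : Finset (List E)) (hs : ∀ l ∈ s, G.IsPath x l x) :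
    ∃ τ y, G.IsPath x τ y ∧ y ∉ H ∧ ∀ l ∈ s, l ≠ [] → ¬ τ <+: l ++ τ := by
  by_cases hc : ∃ l ∈ s, l ≠ []
  · obtain ⟨l, hl, hl'⟩ := hc
    have hex' : ¬ ∀ e f, G.Reaches x (G.src e) → G.src e = G.src f →
        G.rng e ∉ H → G.rng f ∉ H → e = f := fun h => hex ⟨hx, ⟨l, hl', hs l hl⟩, h⟩
    push Not at hex'
    obtain ⟨e, f, hxe, hef, he, hf, hne⟩ := hex'
    obtain ⟨π, hπ⟩ := reaches_iff_exists_isPath.1 hxe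
    obtain ⟨q, hq, hlen⟩ := exists_long_closed (hs l hl) hl' (s.sup List.length * s.sup List.length)
    have hρ := hq.append hπ
    -- Of the two ways to leave at the far end, at most one is periodic.
    by_cases h₁ : ∀ l ∈ s, l ≠ [] → ¬ (q ++ π) ++ [e] <+: l ++ ((q ++ π) ++ [e])
    · exact ⟨_, _, hρ.append (show G.IsPath _ [e] _ from ⟨rfl, rfl⟩), he, h₁⟩
    by_cases h₂ : ∀ l ∈ s, l ≠ [] → ¬ (q ++ π) ++ [f] <+: l ++ ((q ++ π) ++ [f])
    · exact ⟨_, _, hρ.append (show G.IsPath _ [f] _ from ⟨hef.symm, rfl⟩), hf, h₂⟩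
    push Not at h₁ h₂
    obtain ⟨l₁, hs₁, hl₁, h₁⟩ := h₁
    obtain ⟨l₂, hs₂, hl₂, h₂⟩ := h₂
    refine absurd (eq_of_prefix_of_prefix h₁ h₂ hl₁ hl₂ ?_) hne
    rw [List.length_append]
    exact (Nat.mul_le_mul (Finset.le_sup (f := List.length) hs₁)
      (Finset.le_sup (f := List.length) hs₂)).trans (hlen.trans (Nat.le_add_right _ _))
  · push Not at hc
    exact ⟨[], x, rfl, hx, fun l hl hl' => absurd (hc l hl) hl'⟩

end DirectedGraph

/-! ### The vertices and the closed paths in an ideal determine the ideal -/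

namespace LeavittPathAlgebra

open LeavittPath DirectedGraph

variable {K : Type w} [Field K] {V : Type u} {E : Type v} {G : DirectedGraph V E}

/-- The set of vertices that lie in a two-sided ideal. -/
def vertexSet (I : TwoSidedIdeal (LeavittPathAlgebra K G)) : Set V := {x | vtx K G x ∈ I}

theorem mem_vertexSet {I : TwoSidedIdeal (LeavittPathAlgebra K G)} {x : V} :
    x ∈ vertexSet I ↔ vtx K G x ∈ I := Iff.rfl

theorem isHereditary_vertexSet (I : TwoSidedIdeal (LeavittPathAlgebra K G)) :
    G.IsHereditary (vertexSet I) := by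
  intro x y hx hxy
  obtain ⟨l, hl⟩ := reaches_iff_exists_isPath.1 hxy
  rw [mem_vertexSet, ← ghostElt_mul_pathElt_self hl, ← ghostElt_mul_vtx hl]
  exact I.mul_mem_right _ _ (I.mul_mem_left _ _ hx)

theorem isSaturated_vertexSet (I : TwoSidedIdeal (LeavittPathAlgebra K G)) :
    G.IsSaturated (vertexSet I) := by
  intro x hne hfin h
  rw [mem_vertexSet, ← mem_toSubmodule, vtx_eq_sum hne hfin]
  refine Submodule.sum_mem _ fun e he => ?_
  rw [← edge_mul_vtx_rng]
  exact I.mul_mem_right _ _ (I.mul_mem_left _ _ (h ⟨e, hfin.mem_toFinset.1 he, rfl⟩))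

variable (K G) in
/-- The span of the closed paths at `x`. -/
noncomputable def closedSpan (x : V) : Submodule K (LeavittPathAlgebra K G) :=
  Submodule.span K {a | ∃ l, G.IsPath x l x ∧ a = pathElt K G l x}

/-- An element of `I` that is a combination of closed paths at `x` with a nonzero constant term
can only exist if `x` lies in `I` or is exit-free outside of `I`: otherwise compressing by an
aperiodic path isolates the constant term. -/
theorem mem_or_isExitFree {I : TwoSidedIdeal (LeavittPathAlgebra K G)} {x : V} (c : List E →₀ K)
    (hcl : ∀ l ∈ c.support, G.IsPath x l x) (h0 : c [] ≠ 0)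
    (hI : Finsupp.linearCombination K (pathElt K G · x) c ∈ I) :
    x ∈ vertexSet I ∨ G.IsExitFree (vertexSet I) x := by
  by_contra! hx
  obtain ⟨τ, y, hτ, hy, haper⟩ := exists_aperiodic hx.1 hx.2 c.support hcl
  have key : ghostElt K G τ y * Finsupp.linearCombination K (pathElt K G · x) c *
      pathElt K G τ y = c [] • vtx K G y := by
    rw [Finsupp.linearCombination_apply, Finsupp.sum, Finset.mul_sum, Finset.sum_mul,
      Finset.sum_eq_single_of_mem [] (Finsupp.mem_support_iff.2 h0)]
    · rw [pathElt, mul_smul_comm, smul_mul_assoc, ghostElt_mul_vtx hτ,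
        ghostElt_mul_pathElt_self hτ]
    · intro l hl hne
      rw [mul_smul_comm, smul_mul_assoc, mul_assoc, pathElt_mul_pathElt _ hτ,
        ghostElt_mul_pathElt_eq_zero (haper l hl hne) (by simp), smul_zero]
  apply hy
  rw [mem_vertexSet, ← inv_smul_smul₀ h0 (vtx K G y), ← key]
  exact smul_mem I _ (I.mul_mem_right _ _ (I.mul_mem_left _ _ hI))

/-- The part of the determination theorem that concerns combinations of real paths with a common
end. A shortest path `l₀` of the combination is split off: the terms `l₀ l'` with `l'` closed form
the multiple `l₀ (l₀* p)` of a combination of closed paths, and the rest has fewer terms. -/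
theorem sum_pathElt_mem_of_mem {I J : TwoSidedIdeal (LeavittPathAlgebra K G)}
    (hv : vertexSet I ⊆ vertexSet J)
    (hc : ∀ x, G.IsExitFree (vertexSet I) x → ∀ a ∈ closedSpan K G x, a ∈ I → a ∈ J)
    {x : V} (c : List E →₀ K) (hI : Finsupp.linearCombination K (pathElt K G · x) c ∈ I) :
    Finsupp.linearCombination K (pathElt K G · x) c ∈ J := by
  classical
  induction hn : c.support.card using Nat.strong_induction_on generalizing c with
  | _ n ih =>
  subst hn
  rcases c.support.eq_empty_or_nonempty with h | hne
  · rw [Finsupp.support_eq_empty.1 h, map_zero]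
    exact J.zero_mem
  obtain ⟨l₀, hl₀, hmin⟩ := c.support.exists_min_image List.length hne
  set T := Finsupp.linearCombination K (pathElt K G · x) with hT
  by_cases hp : ∃ y, G.IsPath y l₀ x
  swap
  · -- If `l₀` is not a path its term vanishes.
    push Not at hp
    have h : T c = T (c.erase l₀) := by
      conv_lhs => rw [← Finsupp.single_add_erase l₀ c]
      rw [map_add, hT, Finsupp.linearCombination_single, pathElt_eq_zero hp, smul_zero, zero_add]
    rw [h] at hI ⊢
    refine ih _ ?_ _ hI rfl
    rw [Finsupp.support_erase]
    exact Finset.card_erase_lt_of_mem hl₀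
  obtain ⟨y, hp⟩ := hp
  let P : List E → Prop := fun l => ∃ l', l = l₀ ++ l' ∧ G.IsPath x l' x
  have hP₀ : P l₀ := ⟨[], (List.append_nil _).symm, rfl⟩
  have hsplit : T c = T (c.filter P) + T (c.filter fun l => ¬ P l) := by
    rw [← map_add, Finsupp.filter_add_filter_not]
  -- `d` lists the coefficients of the closed paths in `l₀* p`.
  let d : List E →₀ K := (c.filter P).mapDomain (List.drop l₀.length)
  have hd : T d = (c.filter P).sum fun l k => k • pathElt K G (l.drop l₀.length) x := by
    rw [hT, Finsupp.linearCombination_mapDomain, Finsupp.linearCombination_apply]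
    rfl
  have hghost : ghostElt K G l₀ x * T (c.filter P) = T d := by
    rw [hd, hT, Finsupp.linearCombination_apply, Finsupp.sum, Finsupp.sum, Finset.mul_sum]
    refine Finset.sum_congr rfl fun l hl => ?_
    rw [Finsupp.support_filter, Finset.mem_filter] at hl
    obtain ⟨l', rfl, hl'⟩ := hl.2
    rw [mul_smul_comm, ghostElt_mul_pathElt_append hp, vtx_mul_pathElt hl', List.drop_left]
  have hpath : pathElt K G l₀ x * T d = T (c.filter P) := by
    rw [hd, hT, Finsupp.linearCombination_apply, Finsupp.sum, Finsupp.sum, Finset.mul_sum]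
    refine Finset.sum_congr rfl fun l hl => ?_
    rw [Finsupp.support_filter, Finset.mem_filter] at hl
    obtain ⟨l', rfl, hl'⟩ := hl.2
    rw [mul_smul_comm, List.drop_left, pathElt_mul_pathElt _ hl']
  have hrest : ghostElt K G l₀ x * T (c.filter fun l => ¬ P l) = 0 := by
    rw [hT, Finsupp.linearCombination_apply, Finsupp.sum, Finset.mul_sum]
    refine Finset.sum_eq_zero fun l hl => ?_
    rw [Finsupp.support_filter, Finset.mem_filter] at hl
    rw [mul_smul_comm]
    by_cases hpre : l₀ <+: l
    · obtain ⟨l', rfl⟩ := hpre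
      rw [ghostElt_mul_pathElt_append hp, vtx_mul_pathElt_of_not fun h => hl.2 ⟨l', rfl, h⟩,
        smul_zero]
    · rw [ghostElt_mul_pathElt_eq_zero hpre (hmin l hl.1), smul_zero]
  have hdI : T d ∈ I := by
    rw [← hghost, ← add_zero (_ * _), ← hrest, ← mul_add, ← hsplit]
    exact I.mul_mem_left _ _ hI
  have hdcl : ∀ l ∈ d.support, G.IsPath x l x := by
    intro l hl
    obtain ⟨l, h, rfl⟩ := Finset.mem_image.1 (Finsupp.mapDomain_support hl)
    rw [Finsupp.support_filter, Finset.mem_filter] at h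
    obtain ⟨l', rfl, hl'⟩ := h.2
    rwa [List.drop_left]
  have hd0 : d [] ≠ 0 := by
    have hinj : Set.InjOn (List.drop (α := E) l₀.length) {l | P l} := by
      rintro _ ⟨l, rfl, -⟩ _ ⟨l', rfl, -⟩ h
      simpa using h
    have := Finsupp.mapDomain_apply' {l | P l} (c.filter P)
      (fun l hl => (Finset.mem_filter.1 (Finsupp.support_filter P c ▸ hl)).2) hinj hP₀
    rw [List.drop_length] at this
    rw [this, Finsupp.filter_apply_pos _ _ hP₀]
    exact Finsupp.mem_support_iff.1 hl₀
  have hdJ : T d ∈ J := by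
    have hcs : T d ∈ closedSpan K G x := by
      rw [hT, Finsupp.linearCombination_apply]
      exact Submodule.sum_mem _ fun l hl =>
        Submodule.smul_mem _ _ (Submodule.subset_span ⟨l, hdcl l hl, rfl⟩)
    rcases mem_or_isExitFree d hdcl hd0 hdI with hx | hx
    · have hmul : vtx K G x * T d = T d := by
        rw [hT, Finsupp.linearCombination_apply, Finsupp.sum, Finset.mul_sum]
        refine Finset.sum_congr rfl fun l hl => ?_
        rw [mul_smul_comm, vtx_mul_pathElt (hdcl l hl)]
      rw [← hmul]
      exact J.mul_mem_right _ _ (hv hx)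
    · exact hc x hx _ hcs hdI
  have hPI : T (c.filter P) ∈ I := hpath ▸ I.mul_mem_left _ _ hdI
  have hPJ : T (c.filter P) ∈ J := hpath ▸ J.mul_mem_left _ _ hdJ
  rw [hsplit]
  refine J.add_mem hPJ (ih _ ?_ _ ?_ rfl)
  · rw [Finsupp.support_filter]
    exact Finset.card_lt_card (Finset.filter_ssubset.2 ⟨l₀, hl₀, not_not.2 hP₀⟩)
  · have := I.sub_mem hI hPI
    rwa [hsplit, add_sub_cancel_left] at this

/-- If an ideal `J` contains the vertices of `I` and the combinations in `I` of closed paths at the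
exit-free vertices, then it contains `I`. -/
theorem le_of_vertexSet_of_closedSpan (hG : G.RowFinite)
    {I J : TwoSidedIdeal (LeavittPathAlgebra K G)} (hv : vertexSet I ⊆ vertexSet J)
    (hc : ∀ x, G.IsExitFree (vertexSet I) x → ∀ a ∈ closedSpan K G x, a ∈ I → a ∈ J) : I ≤ J := by
  have of_span {x : V} {a : LeavittPathAlgebra K G}
      (ha : a ∈ Submodule.span K (Set.range fun l => pathElt K G l x)) (hI : a ∈ I) : a ∈ J := by
    obtain ⟨c, rfl⟩ := (Finsupp.mem_span_range_iff_exists_finsupp).1 ha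
    exact sum_pathElt_mem_of_mem hv hc c hI
  have key (m : ℕ) : ∀ a ∈ monomialSpan K G m, a ∈ I → a ∈ J := by
    induction m with
    | zero =>
      intro a ha hI
      obtain ⟨F, hF⟩ := exists_eq_sum_mul_vtx a
      rw [← mem_toSubmodule, hF F subset_rfl]
      exact Submodule.sum_mem _ fun x _ =>
        of_span (mul_vtx_mem ha (.inl rfl)) (I.mul_mem_right _ _ hI)
    | succ m ih =>
      intro a ha hI
      obtain ⟨F, hF⟩ := exists_eq_sum_mul_vtx a
      rw [← mem_toSubmodule, hF F subset_rfl]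
      refine Submodule.sum_mem _ fun x _ => ?_
      rcases (G.emitted x).eq_empty_or_nonempty with hx | hx
      · exact of_span (mul_vtx_mem ha (.inr hx)) (I.mul_mem_right _ _ hI)
      · rw [vtx_eq_sum hx (hG x), Finset.mul_sum]
        refine Submodule.sum_mem _ fun e _ => ?_
        rw [← mul_assoc]
        exact J.mul_mem_right _ _ (ih _ (mul_edge_mem ha e) (I.mul_mem_right _ _ hI))
  intro a ha
  obtain ⟨m, hm⟩ := exists_mem_monomialSpan a
  exact key m a hm ha

end LeavittPathAlgebra

/-! ### Closed paths at an exit-free vertex -/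

namespace DirectedGraph

variable {V : Type u} {E : Type v} {G : DirectedGraph V E} {H : Set V}

/-- Outside of `H` an exit-free vertex can be left in one way only. -/
theorem prefix_or_prefix (hH : G.IsHereditary H) {x : V}
    (hx : ∀ e f, G.Reaches x (G.src e) → G.src e = G.src f → G.rng e ∉ H → G.rng f ∉ H → e = f)
    {l l' : List E} {y y' : V} (hl : G.IsPath x l y) (hl' : G.IsPath x l' y') (hy : y ∉ H)
    (hy' : y' ∉ H) : l <+: l' ∨ l' <+: l := by
  induction l generalizing x l' with
  | nil => exact .inl List.nil_prefix
  | cons e l ih =>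
    cases l' with
    | nil => exact .inr List.nil_prefix
    | cons f l' =>
      obtain rfl : e = f := hx e f (by rw [hl.1]; exact .refl) (hl.1.trans hl'.1.symm)
        (fun h => hy (hH _ _ h hl.2.reaches)) (fun h => hy' (hH _ _ h hl'.2.reaches))
      simp only [List.cons_prefix_cons, true_and]
      refine ih (fun e' f' h => hx e' f' (.head ⟨e, hl.1, rfl⟩ h)) hl.2 hl'.2

theorem IsExitFree.reaches_symm (hH : G.IsHereditary H) {x y : V} (hx : G.IsExitFree H x)
    (hy : y ∉ H) (hxy : G.Reaches x y) : G.Reaches y x := by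
  obtain ⟨l, hl⟩ := reaches_iff_exists_isPath.1 hxy
  obtain ⟨c, hc, hcx⟩ := hx.2.1
  obtain ⟨q, hq, hlen⟩ := exists_long_closed hcx hc l.length
  have hpre : l <+: q := by
    rcases prefix_or_prefix hH hx.2.2 hl hq hy hx.1 with h | h
    · exact h
    · rw [h.eq_of_length_le hlen]
  obtain ⟨r, rfl⟩ := hpre
  exact (hl.drop_append hq).reaches

theorem IsExitFree.append_comm (hH : G.IsHereditary H) {x : V} (hx : G.IsExitFree H x)
    {l l' : List E} (hl : G.IsPath x l x) (hl' : G.IsPath x l' x) : l ++ l' = l' ++ l := by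
  have hlen : (l ++ l').length = (l' ++ l).length := by
    rw [List.length_append, List.length_append, add_comm]
  rcases prefix_or_prefix hH hx.2.2 (hl.append hl') (hl'.append hl) hx.1 hx.1 with h | h
  · exact h.eq_of_length hlen
  · exact (h.eq_of_length hlen.symm).symm

/-- An exit-free vertex does not lie in the hereditary saturated closure of `H` and vertices that
do not reach it. -/
theorem IsExitFree.exists_reaches (hH : G.IsHereditary H) {x : V} (hx : G.IsExitFree H x)
    {F : Set V} (h : x ∈ G.hsClosure (H ∪ F)) : ∃ y ∈ F, G.Reaches y x := by
  by_contra! hF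
  have hsub : G.hsClosure (H ∪ F) ⊆ {y | ¬ G.Reaches y x} := by
    refine hsClosure_subset ?_ (fun y z hy hyz hz => hy (hyz.trans hz)) ?_
    · rintro y (hy | hy) hyx
      · exact hx.1 (hH _ _ hy hyx)
      · exact hF y hy hyx
    · intro y _ _ hsub hyx
      obtain ⟨l, hl, hly⟩ : ∃ l, l ≠ [] ∧ G.IsPath y l x := by
        obtain ⟨l, hl⟩ := reaches_iff_exists_isPath.1 hyx
        rcases eq_or_ne l [] with rfl | hne
        · cases hl; exact hx.2.1
        · exact ⟨l, hne, hl⟩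
      cases l with
      | nil => exact hl rfl
      | cons e l => exact hsub ⟨e, hly.1, rfl⟩ hly.2.reaches
  exact hsub h .refl

/-- Under the ascending chain condition there are, up to mutual reachability, only finitely many
exit-free vertices. -/
theorem exists_finset_exitFree (hacc : SatisfiesACC {H : Set V // ∃ X : Set V, H = G.hsClosure X})
    (hH : G.IsHereditary H) :
    ∃ F : Finset V, (∀ y ∈ F, G.IsExitFree H y) ∧
      ∀ x, G.IsExitFree H x → ∃ y ∈ F, G.Reaches y x ∧ G.Reaches x y := by
  classical
  have : WellFoundedGT {H : Set V // ∃ X : Set V, H = G.hsClosure X} := by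
    rw [wellFoundedGT_iff_monotone_chain_condition]
    intro a
    obtain ⟨n, hn⟩ := hacc a fun i => a.monotone i.le_succ
    exact ⟨n, fun m hm => (hn m hm).symm⟩
  obtain ⟨_, ⟨F, hF, rfl⟩, hmax⟩ := (wellFounded_gt (α := {H : Set V // ∃ X : Set V,
    H = G.hsClosure X})).has_min {S | ∃ F : Finset V, (∀ y ∈ F, G.IsExitFree H y) ∧
      S = ⟨G.hsClosure (H ∪ F), _, rfl⟩} ⟨_, ∅, by simp, rfl⟩
  refine ⟨F, hF, fun x hx => ?_⟩
  have hle : G.hsClosure (H ∪ F) ⊆ G.hsClosure (H ∪ (insert x F : Finset V)) :=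
    hsClosure_subset ((Set.union_subset_union_right H (by simp)).trans (subset_hsClosure _))
      (isHereditary_hsClosure _) (isSaturated_hsClosure _)
  have hge : ¬ G.hsClosure (H ∪ F) ⊂ G.hsClosure (H ∪ (insert x F : Finset V)) :=
    hmax ⟨_, _, rfl⟩ ⟨insert x F, by simpa using ⟨hx, hF⟩, rfl⟩
  have hxF : x ∈ G.hsClosure (H ∪ F) := by
    rw [eq_of_le_of_not_lt hle hge]
    exact subset_hsClosure _ (.inr (by simp))
  obtain ⟨y, hy, hyx⟩ := hx.exists_reaches hH hxF
  exact ⟨y, hy, hyx, (hF y hy).reaches_symm hH hx.1 hyx⟩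

end DirectedGraph

/-! ### Ascending chains of ideals -/

namespace LeavittPathAlgebra

open LeavittPath DirectedGraph

variable {K : Type w} [Field K] {V : Type u} {E : Type v} {G : DirectedGraph V E} {H : Set V}

theorem mul_pathElt_comm (hH : G.IsHereditary H) {x : V} (hx : G.IsExitFree H x)
    {l : List E} (hl : G.IsPath x l x) {a : LeavittPathAlgebra K G} (ha : a ∈ closedSpan K G x) :
    a * pathElt K G l x = pathElt K G l x * a := by
  induction ha using Submodule.span_induction with
  | zero => rw [zero_mul, mul_zero]
  | add a b _ _ ha hb => rw [add_mul, mul_add, ha, hb]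
  | smul k a _ ha => rw [smul_mul_assoc, mul_smul_comm, ha]
  | mem a ha =>
    obtain ⟨l', hl', rfl⟩ := ha
    rw [pathElt_mul_pathElt _ hl, pathElt_mul_pathElt _ hl', hx.append_comm hH hl hl']

/-- Conjugation by a path transports the combinations of closed paths in an ideal between mutually
reachable vertices. -/
theorem closedSpan_transport (hH : G.IsHereditary H) {x y : V} (hx : G.IsExitFree H x)
    (hyx : G.Reaches y x) (hxy : G.Reaches x y) {I J : TwoSidedIdeal (LeavittPathAlgebra K G)}
    (hIJ : ∀ a ∈ closedSpan K G y, a ∈ I → a ∈ J) :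
    ∀ a ∈ closedSpan K G x, a ∈ I → a ∈ J := by
  obtain ⟨π, hπ⟩ := reaches_iff_exists_isPath.1 hyx
  obtain ⟨ρ, hρ⟩ := reaches_iff_exists_isPath.1 hxy
  intro a ha hI
  have hmem : pathElt K G π x * a * pathElt K G ρ y ∈ closedSpan K G y := by
    clear hI
    induction ha using Submodule.span_induction with
    | zero => rw [mul_zero, zero_mul]; exact Submodule.zero_mem _
    | add a b _ _ ha hb => rw [mul_add, add_mul]; exact Submodule.add_mem _ ha hb
    | smul k a _ ha => rw [mul_smul_comm, smul_mul_assoc]; exact Submodule.smul_mem _ k ha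
    | mem a ha =>
      obtain ⟨l, hl, rfl⟩ := ha
      rw [pathElt_mul_pathElt _ hl, pathElt_mul_pathElt _ hρ]
      exact Submodule.subset_span ⟨_, (hπ.append hl).append hρ, rfl⟩
  have hJ := hIJ _ hmem (I.mul_mem_right _ _ (I.mul_mem_left _ _ hI))
  have hxa : vtx K G x * a = a := by
    clear hI hmem hJ
    induction ha using Submodule.span_induction with
    | zero => rw [mul_zero]
    | add a b _ _ ha hb => rw [mul_add, ha, hb]
    | smul k a _ ha => rw [mul_smul_comm, ha]
    | mem a ha =>
      obtain ⟨l, hl, rfl⟩ := ha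
      exact vtx_mul_pathElt hl
  -- As closed paths at `x` commute, `a` is recovered from `π a ρ`.
  have key : ghostElt K G (ρ ++ π) x * (ghostElt K G π x *
      (pathElt K G π x * a * pathElt K G ρ y) * pathElt K G π x) = a := by
    rw [← mul_assoc (ghostElt K G π x), ← mul_assoc (ghostElt K G π x),
      ghostElt_mul_pathElt_self hπ, hxa, mul_assoc a, pathElt_mul_pathElt _ hπ,
      mul_pathElt_comm hH hx (hρ.append hπ) ha, ← mul_assoc,
      ghostElt_mul_pathElt_self (hρ.append hπ), hxa]
  rw [← key]
  exact J.mul_mem_left _ _ (J.mul_mem_right _ _ (J.mul_mem_left _ _ hJ))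

open Polynomial

variable (K G) in
/-- Evaluation of polynomials at a closed path `c` based at `x`, with `x` as the unit. -/
noncomputable def evalClosed (c : List E) (x : V) : K[X] →ₗ[K] LeavittPathAlgebra K G :=
  Polynomial.lsum fun n =>
    LinearMap.toSpanSingleton K _ (pathElt K G (List.replicate n c).flatten x)

theorem isPath_replicate {c : List E} {x : V} (hc : G.IsPath x c x) (n : ℕ) :
    G.IsPath x (List.replicate n c).flatten x := by
  induction n with
  | zero => rfl
  | succ n ih => rw [List.replicate_succ, List.flatten_cons]; exact hc.append ih

theorem evalClosed_monomial (c : List E) (x : V) (n : ℕ) (k : K) :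
    evalClosed K G c x (monomial n k) = k • pathElt K G (List.replicate n c).flatten x := by
  simp [evalClosed, Polynomial.lsum_apply, Polynomial.sum_monomial_index]

theorem evalClosed_X_mul {c : List E} {x : V} (hc : G.IsPath x c x) (p : K[X]) :
    evalClosed K G c x (X * p) = pathElt K G c x * evalClosed K G c x p := by
  induction p using Polynomial.induction_on' with
  | add p q hp hq => rw [mul_add, map_add, map_add, mul_add, hp, hq]
  | monomial n k =>
    rw [X_mul_monomial, evalClosed_monomial, evalClosed_monomial, mul_smul_comm,
      pathElt_mul_pathElt _ (isPath_replicate hc n), List.replicate_succ, List.flatten_cons]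

/-- The polynomials whose value at a closed path lies in a given ideal. -/
noncomputable def polyIdeal (I : TwoSidedIdeal (LeavittPathAlgebra K G)) {c : List E} {x : V}
    (hc : G.IsPath x c x) : Ideal K[X] where
  carrier := {p | evalClosed K G c x p ∈ I}
  zero_mem' := by simp [I.zero_mem]
  add_mem' hp hq := by simpa using I.add_mem hp hq
  smul_mem' q p hp := by
    have hX (n : ℕ) : evalClosed K G c x (X ^ n * p) ∈ I := by
      induction n with
      | zero => simpa using hp
      | succ n ih =>
        rw [pow_succ', mul_assoc, evalClosed_X_mul hc]
        exact I.mul_mem_left _ _ ih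
    change evalClosed K G c x (q * p) ∈ I
    induction q using Polynomial.induction_on' with
    | add q r hq hr => rw [add_mul, map_add]; exact I.add_mem hq hr
    | monomial n k =>
      rw [← C_mul_X_pow_eq_monomial, mul_assoc, ← smul_eq_C_mul, map_smul]
      exact smul_mem I k (hX n)

/-- At an exit-free vertex all closed paths are powers of a shortest one. -/
theorem exists_closedSpan_le_range (hH : G.IsHereditary H) {x : V} (hx : G.IsExitFree H x) :
    ∃ c, G.IsPath x c x ∧ closedSpan K G x ≤ LinearMap.range (evalClosed K G c x) := by
  obtain ⟨c, ⟨hne, hc⟩, hmin⟩ := exists_minimalFor_of_wellFoundedLT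
    (fun l : List E => l ≠ [] ∧ G.IsPath x l x) List.length hx.2.1
  refine ⟨c, hc, Submodule.span_le.2 ?_⟩
  rintro _ ⟨l, hl, rfl⟩
  induction hn : l.length using Nat.strong_induction_on generalizing l with
  | _ n ih =>
  subst hn
  rcases eq_or_ne l [] with rfl | hl0
  · exact ⟨monomial 0 1, by rw [evalClosed_monomial, one_smul]; rfl⟩
  have hpre : c <+: l := by
    rcases prefix_or_prefix hH hx.2.2 hc hl hx.1 hx.1 with h | h
    · exact h
    · rw [h.eq_of_length_le (hmin ⟨hl0, hl⟩ h.length_le)]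
  obtain ⟨l', rfl⟩ := hpre
  have hl' := hc.drop_append hl
  obtain ⟨p, hp⟩ := ih l'.length (by simpa using List.length_pos_iff.2 hne) l' hl' rfl
  exact ⟨X * p, by rw [evalClosed_X_mul hc, hp, pathElt_mul_pathElt _ hl']⟩

/-- At an exit-free vertex the combinations of closed paths form a quotient of `K[X]`, so that an
ascending chain of ideals becomes stationary there. -/
theorem exists_closedSpan_stable (hH : G.IsHereditary H) {x : V} (hx : G.IsExitFree H x)
    {I : ℕ → TwoSidedIdeal (LeavittPathAlgebra K G)} (hI : Monotone I) :
    ∃ n, ∀ m, ∀ a ∈ closedSpan K G x, a ∈ I m → a ∈ I n := by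
  obtain ⟨c, hc, hle⟩ := exists_closedSpan_le_range (K := K) hH hx
  obtain ⟨n, hn⟩ := monotone_stabilizes_iff_noetherian.2 (inferInstance : IsNoetherian K[X] K[X])
    ⟨fun n => polyIdeal (I n) hc, fun i j hij p hp => hI hij hp⟩
  refine ⟨n, fun m a ha hm => ?_⟩
  rcases le_total n m with h | h
  · obtain ⟨p, rfl⟩ := hle ha
    have : p ∈ polyIdeal (I m) hc := hm
    rwa [← show polyIdeal (I n) hc = polyIdeal (I m) hc from hn m h] at this
  · exact hI h hm

theorem acc_ideals_of_acc_hsClosure (hG : G.RowFinite)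
    (hacc : SatisfiesACC {H : Set V // ∃ X : Set V, H = G.hsClosure X}) :
    SatisfiesACC (TwoSidedIdeal (LeavittPathAlgebra K G)) := by
  intro I hI
  have hmono : Monotone I := monotone_nat_of_le_succ hI
  obtain ⟨N, hN⟩ := hacc (fun i => ⟨vertexSet (I i), vertexSet (I i),
    (hsClosure_eq_self (isHereditary_vertexSet _) (isSaturated_vertexSet _)).symm⟩)
    fun i x hx => hI i hx
  have hH := isHereditary_vertexSet (I N)
  have hvert (n : ℕ) (hn : N ≤ n) : vertexSet (I n) = vertexSet (I N) :=
    congrArg Subtype.val (hN n hn)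
  obtain ⟨F, hF, hrep⟩ := exists_finset_exitFree hacc hH
  choose! s hs using fun y (hy : G.IsExitFree (vertexSet (I N)) y) =>
    exists_closedSpan_stable hH hy hmono
  have hNM : N ≤ max N (F.sup s) := le_max_left _ _
  refine ⟨max N (F.sup s), fun i hi => le_antisymm ?_ (hmono hi)⟩
  have hvi := hvert i (hNM.trans hi)
  refine le_of_vertexSet_of_closedSpan hG (by rw [hvi, hvert _ hNM]) ?_
  rw [hvi]
  intro x hx
  obtain ⟨y, hy, hyx, hxy⟩ := hrep x hx
  exact closedSpan_transport hH hx hyx hxy fun a ha hai =>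
    hmono ((Finset.le_sup hy).trans (le_max_right _ _)) (hs y (hF y hy) i a ha hai)

end LeavittPathAlgebra

/-! ### A representation that detects a hereditary saturated set -/

namespace LeavittPathAlgebra

open LeavittPath DirectedGraph

variable {K : Type w} [Field K] {V : Type u} {E : Type v} {G : DirectedGraph V E}

/-- The homomorphism from `L_K(G)` given by images of the generators that satisfy the
relations. -/
theorem exists_lift {A : Type*} [NonUnitalRing A] [Module K A] [IsScalarTower K A A]
    [SMulCommClass K A A] (ψ : LeavittGen V E → A)
    (hψ : ∀ a b, Rel K G a b → MonoidAlgebra.liftMagma K (FreeSemigroup.lift ψ) a =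
      MonoidAlgebra.liftMagma K (FreeSemigroup.lift ψ) b) :
    ∃ φ : LeavittPathAlgebra K G →ₙ+* A, ∀ g, φ (mk K G (freeGen K g)) = ψ g := by
  set Φ := MonoidAlgebra.liftMagma K (FreeSemigroup.lift ψ) with hΦ
  have hcon (a b : FreeAlg K V E) (h : con K G a b) : Φ a = Φ b := by
    change RingConGen.Rel _ a b at h
    induction h with
    | of x y h =>
      obtain ⟨k, a, b, h, rfl, rfl⟩ := h
      rw [map_smul, map_smul, hψ a b h]
    | refl x => rfl
    | symm _ ih => exact ih.symm
    | trans _ _ ih₁ ih₂ => exact ih₁.trans ih₂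
    | add _ _ ih₁ ih₂ => rw [map_add, map_add, ih₁, ih₂]
    | mul _ _ ih₁ ih₂ => rw [map_mul, map_mul, ih₁, ih₂]
  let f : LeavittPathAlgebra K G → A := Quotient.lift Φ hcon
  have hf (a : FreeAlg K V E) : f (mk K G a) = Φ a := rfl
  refine ⟨{ toFun := f, map_zero' := ?_, map_add' := ?_, map_mul' := ?_ }, fun g => ?_⟩
  · intro a b
    obtain ⟨a, rfl⟩ := mk_surjective K G a
    obtain ⟨b, rfl⟩ := mk_surjective K G b
    rw [← map_mul, hf, hf, hf, map_mul]
  · rw [← map_zero (mk K G), hf, map_zero]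
  · intro a b
    obtain ⟨a, rfl⟩ := mk_surjective K G a
    obtain ⟨b, rfl⟩ := mk_surjective K G b
    rw [← map_add, hf, hf, hf, map_add]
  · change f (mk K G (freeGen K g)) = ψ g
    rw [hf, hΦ, freeGen, freeWord, MonoidAlgebra.liftMagma_apply_apply]
    simp

variable (K) in
/-- The operator on functions that restricts to the set where `p` holds and substitutes `t`. -/
noncomputable def restrictComp {X : Type*} (p : X → Prop) (t : X → X) :
    Module.End K (X → K) := by
  classical
  exact
  { toFun g x := if p x then g (t x) else 0
    map_add' g h := by
      ext x
      by_cases hp : p x <;> simp [hp]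
    map_smul' k g := by
      ext x
      by_cases hp : p x <;> simp [hp] }

open Classical in
theorem restrictComp_apply {X : Type*} (p : X → Prop) (t : X → X) (g : X → K) (x : X) :
    restrictComp K p t g x = if p x then g (t x) else 0 := rfl

theorem restrictComp_mul {X : Type*} (p q : X → Prop) (t s : X → X) :
    restrictComp K p t * restrictComp K q s =
      restrictComp K (fun x => p x ∧ q (t x)) (s ∘ t) := by
  ext g x
  by_cases hp : p x <;> by_cases hq : q (t x) <;> simp [restrictComp_apply, hp, hq]

theorem restrictComp_congr {X : Type*} {p q : X → Prop} {t s : X → X}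
    (h : ∀ x, p x ↔ q x) (hts : ∀ x, p x → t x = s x) :
    restrictComp K p t = restrictComp K q s := by
  obtain rfl : p = q := funext fun x => propext (h x)
  ext g x
  by_cases hp : p x <;> simp [restrictComp_apply, hp, hts]

theorem restrictComp_eq_zero {X : Type*} {p : X → Prop} {t : X → X} (h : ∀ x, ¬ p x) :
    restrictComp K p t = 0 := by
  ext g x
  simp [restrictComp_apply, h]

/-- At a vertex `x` outside of the saturated set `H` that is not a sink, `ℕ` is matched with the
disjoint union of copies of `ℕ`, one for each of the finitely many edges from `x` that end outside
of `H`: a number `n` is the place `tl n` in the copy of the edge `hd n`, and `sh e m` is the place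
`m` in the copy of `e`. -/
theorem exists_matching (hG : G.RowFinite) {H : Set V} (hS : G.IsSaturated H) (x : V) :
    ∃ (hd : ℕ → Option E) (tl : ℕ → ℕ) (sh : E → ℕ → ℕ),
      (∀ n e, hd n = some e → G.rng e ∉ H ∧ G.src e = x ∧ sh e (tl n) = n) ∧
      (∀ e m, x ∉ H → G.rng e ∉ H → G.src e = x → hd (sh e m) = some e ∧ tl (sh e m) = m) ∧
      (x ∉ H → (G.emitted x).Nonempty → ∀ n, ∃ e, hd n = some e) := by
  classical
  by_cases hx : x ∉ H ∧ (G.emitted x).Nonempty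
  swap
  · exact ⟨fun _ => none, id, fun _ => id, fun _ _ h => by simp at h,
      fun e _ h _ he => absurd ⟨h, e, he⟩ hx, fun h h' => absurd ⟨h, h'⟩ hx⟩
  have : Finite {e // G.src e = x ∧ G.rng e ∉ H} :=
    ((hG x).subset fun e he => he.1 : {e | G.src e = x ∧ G.rng e ∉ H}.Finite).to_subtype
  have : Nonempty {e // G.src e = x ∧ G.rng e ∉ H} := by
    by_contra hemp
    refine hx.1 (hS x hx.2 (hG x) ?_)
    rintro _ ⟨e, he, rfl⟩
    by_contra hr
    exact hemp ⟨⟨e, he, hr⟩⟩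
  have : Countable {e // G.src e = x ∧ G.rng e ∉ H} := Finite.to_countable
  obtain ⟨ε⟩ : Nonempty (ℕ ≃ {e // G.src e = x ∧ G.rng e ∉ H} × ℕ) := nonempty_equiv_of_countable
  refine ⟨fun n => some (ε n).1, fun n => (ε n).2,
    fun e m => if h : G.src e = x ∧ G.rng e ∉ H then ε.symm (⟨e, h⟩, m) else m, ?_, ?_,
    fun _ _ n => ⟨_, rfl⟩⟩
  · intro n e he
    obtain rfl := Option.some.inj he
    exact ⟨(ε n).1.2.2, (ε n).1.2.1, by simp [(ε n).1.2]⟩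
  · intro e m _ hr hs
    simp [hr, hs]

/-- For a hereditary saturated set `H` there is a representation of `L_K(G)` in which a vertex
acts as zero exactly if it lies in `H`. It acts on the functions on `V × ℕ`: a vertex outside of `H`
restricts functions to its own copy of `ℕ`, and an edge that ends outside of `H` transports
functions along the matching of these copies given by `exists_matching`. -/
theorem exists_representation (hG : G.RowFinite) {H : Set V} (hH : G.IsHereditary H)
    (hS : G.IsSaturated H) :
    ∃ φ : LeavittPathAlgebra K G →ₙ+* Module.End K (V × ℕ → K),
      ∀ x, φ (vtx K G x) = 0 ↔ x ∈ H := by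
  classical
  have hout {e : E} (he : G.rng e ∉ H) : G.src e ∉ H :=
    fun h => he (hH _ _ h (.single ⟨e, rfl, rfl⟩))
  -- A point `z` with `head z = some e` is the image of `tail z` under the partial injection
  -- `shift e`, which is defined on the copy of `ℕ` at the end of `e`.
  have hstruct : ∃ (head : V × ℕ → Option E) (tail : V × ℕ → V × ℕ) (shift : E → V × ℕ → V × ℕ),
      (∀ z e, head z = some e →
        G.rng e ∉ H ∧ G.src e = z.1 ∧ (tail z).1 = G.rng e ∧ shift e (tail z) = z) ∧
      (∀ z e, G.rng e ∉ H → z.1 = G.rng e → head (shift e z) = some e ∧ tail (shift e z) = z) ∧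
      ∀ z, z.1 ∉ H → (G.emitted z.1).Nonempty → ∃ e, head z = some e := by
    choose hd tl sh h₁ h₂ h₃ using exists_matching hG (H := H) hS
    refine ⟨fun z => hd z.1 z.2, fun z => ((hd z.1 z.2).elim z.1 G.rng, tl z.1 z.2),
      fun e z => (G.src e, sh (G.src e) e z.2), ?_, ?_, fun z hz hne => h₃ z.1 hz hne z.2⟩
    · intro z e he
      obtain ⟨hr, hs, hsh⟩ := h₁ z.1 z.2 e he
      refine ⟨hr, hs, by simp [he], Prod.ext hs ?_⟩
      simpa [hs] using hsh
    · intro z e he hz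
      obtain ⟨h, h'⟩ := h₂ (G.src e) e z.2 (hout he) he rfl
      exact ⟨h, Prod.ext (by simp [h, hz]) h'⟩
  obtain ⟨head, tail, shift, h₁, h₂, h₃⟩ := hstruct
  let ψ : LeavittGen V E → Module.End K (V × ℕ → K)
    | .vertex x => restrictComp K (fun z => z.1 = x ∧ x ∉ H) id
    | .edge e => restrictComp K (fun z => head z = some e) tail
    | .ghost e => restrictComp K (fun z => z.1 = G.rng e ∧ G.rng e ∉ H) (shift e)
  have hgen (g : LeavittGen V E) :
      MonoidAlgebra.liftMagma K (FreeSemigroup.lift ψ) (freeGen K g) = ψ g := by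
    rw [freeGen, freeWord, MonoidAlgebra.liftMagma_apply_apply]
    simp
  obtain ⟨φ, hφ⟩ := exists_lift (K := K) (G := G) ψ (by
    rintro _ _ (x | ⟨x, y, h⟩ | e | e | e | e | e | ⟨e, f, h⟩ | ⟨x, hne, hfin⟩) <;>
      simp only [map_mul, map_sum, map_zero, hgen, ψ, restrictComp_mul]
    · exact restrictComp_congr (by simp) (by simp)
    · exact restrictComp_eq_zero fun z hz => h (hz.1.1.symm.trans hz.2.1)
    · refine restrictComp_congr (fun z => ⟨fun h => h.2, fun h => ⟨?_, h⟩⟩) (by simp)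
      exact ⟨(h₁ z e h).2.1.symm, hout (h₁ z e h).1⟩
    · refine restrictComp_congr (fun z => ⟨fun h => h.1, fun h => ⟨h, ?_⟩⟩) (by simp)
      exact ⟨(h₁ z e h).2.2.1, (h₁ z e h).1⟩
    · exact restrictComp_congr (by simp) (by simp)
    · refine restrictComp_congr (fun z => ⟨fun h => h.1, fun h => ⟨h, ?_⟩⟩) (by simp)
      exact ⟨(h₁ _ _ (h₂ z e h.2 h.1).1).2.1.symm, hout h.2⟩
    · exact restrictComp_congr (fun z => ⟨fun h => h.1, fun h => ⟨h, (h₂ z e h.2 h.1).1⟩⟩)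
        fun z hz => (h₂ z e hz.1.2 hz.1.1).2
    · refine restrictComp_eq_zero fun z hz => h ?_
      have := (h₂ z e hz.1.2 hz.1.1).1.symm.trans hz.2
      simpa using this
    · ext1 g
      ext z
      rw [LinearMap.sum_apply, Finset.sum_apply]
      simp only [restrictComp_apply]
      by_cases hz : z.1 = x ∧ x ∉ H
      · obtain ⟨rfl, hz⟩ := hz
        obtain ⟨e, he⟩ := h₃ z hz hne
        have h := h₁ z e he
        rw [if_pos ⟨rfl, hz⟩, Finset.sum_eq_single_of_mem e (hfin.mem_toFinset.2 h.2.1),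
          if_pos ⟨he, h.2.2.1, h.1⟩]
        · rw [Function.comp_apply, h.2.2.2, id]
        · intro f _ hf
          exact if_neg fun h' => hf (Option.some.inj (h'.1.symm.trans he))
      · rw [if_neg hz]
        refine (Finset.sum_eq_zero fun e he => if_neg fun h => hz ?_).symm
        have h' := h₁ z e h.1
        have hex : G.src e = x := hfin.mem_toFinset.1 he
        exact ⟨h'.2.1.symm.trans hex, hex ▸ hout h'.1⟩)
  refine ⟨φ, fun x => ?_⟩
  rw [vtx, hφ]
  refine ⟨fun h => ?_, fun h => restrictComp_eq_zero fun z hz => hz.2 h⟩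
  by_contra hx
  have := congrFun (LinearMap.congr_fun h fun _ => 1) (x, 0)
  simp [ψ, restrictComp_apply, hx] at this

/-! ### The graded ideal of a set of vertices -/

variable (K G) in
/-- The span of the words that contain a vertex of `H` as an inner letter. -/
noncomputable def vertexSpan (H : Set V) : Submodule K (LeavittPathAlgebra K G) :=
  Submodule.span K {a | ∃ (m m' : FreeSemigroup (LeavittGen V E)) (x : V), x ∈ H ∧
    a = mk K G (freeWord K (m * FreeSemigroup.of (.vertex x) * m'))}

variable (K G) in
/-- The two-sided ideal generated by the vertices in `H`, encoded as the span of the words that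
contain such a vertex as an inner letter; it contains `x ∈ H` because `x = x x x`. -/
noncomputable def vertexIdeal (H : Set V) : TwoSidedIdeal (LeavittPathAlgebra K G) :=
  TwoSidedIdeal.mk' (vertexSpan K G H) (Submodule.zero_mem _) (Submodule.add_mem _)
    (Submodule.neg_mem _)
    (by
      intro a b hb
      change b ∈ vertexSpan K G H at hb
      change a * b ∈ vertexSpan K G H
      induction mem_span_words a using Submodule.span_induction with
      | zero => rw [zero_mul]; exact Submodule.zero_mem _
      | add a a' _ _ ha ha' => rw [add_mul]; exact Submodule.add_mem _ ha ha'
      | smul k a _ ha => rw [smul_mul_assoc]; exact Submodule.smul_mem _ k ha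
      | mem a ha =>
        obtain ⟨n, rfl⟩ := ha
        induction hb using Submodule.span_induction with
        | zero => rw [mul_zero]; exact Submodule.zero_mem _
        | add b b' _ _ hb hb' => rw [mul_add]; exact Submodule.add_mem _ hb hb'
        | smul k b _ hb => rw [mul_smul_comm]; exact Submodule.smul_mem _ k hb
        | mem b hb =>
          obtain ⟨m, m', x, hx, rfl⟩ := hb
          exact Submodule.subset_span
            ⟨n * m, m', x, hx, by simp only [← mk_freeWord_mul, mul_assoc]⟩)
    (by
      intro b a hb
      change b ∈ vertexSpan K G H at hb
      change b * a ∈ vertexSpan K G H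
      induction mem_span_words a using Submodule.span_induction with
      | zero => rw [mul_zero]; exact Submodule.zero_mem _
      | add a a' _ _ ha ha' => rw [mul_add]; exact Submodule.add_mem _ ha ha'
      | smul k a _ ha => rw [mul_smul_comm]; exact Submodule.smul_mem _ k ha
      | mem a ha =>
        obtain ⟨n, rfl⟩ := ha
        induction hb using Submodule.span_induction with
        | zero => rw [zero_mul]; exact Submodule.zero_mem _
        | add b b' _ _ hb hb' => rw [add_mul]; exact Submodule.add_mem _ hb hb'
        | smul k b _ hb => rw [smul_mul_assoc]; exact Submodule.smul_mem _ k hb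
        | mem b hb =>
          obtain ⟨m, m', x, hx, rfl⟩ := hb
          exact Submodule.subset_span
            ⟨m, m' * n, x, hx, by simp only [← mk_freeWord_mul, mul_assoc]⟩)

theorem mem_vertexIdeal {H : Set V} {a : LeavittPathAlgebra K G} :
    a ∈ vertexIdeal K G H ↔ a ∈ vertexSpan K G H :=
  TwoSidedIdeal.mem_mk' ..

theorem vertexIdeal_mono {H H' : Set V} (h : H ⊆ H') : vertexIdeal K G H ≤ vertexIdeal K G H' := by
  intro a
  rw [mem_vertexIdeal, mem_vertexIdeal]
  refine fun ha => Submodule.span_mono ?_ ha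
  rintro _ ⟨m, m', x, hx, e⟩
  exact ⟨m, m', x, h hx, e⟩

theorem isGradedIdeal_vertexIdeal (H : Set V) : IsGradedIdeal (vertexIdeal K G H) := by
  classical
  intro a ha
  rw [mem_vertexIdeal] at ha
  simp only [mem_vertexIdeal]
  induction ha using Submodule.span_induction with
  | zero => exact ⟨0, by simp, by simp⟩
  | add a b _ _ ha hb =>
    obtain ⟨c, hc, rfl⟩ := ha
    obtain ⟨d, hd, rfl⟩ := hb
    exact ⟨c + d, fun n => ⟨Submodule.add_mem _ (hc n).1 (hd n).1,
      Submodule.add_mem _ (hc n).2 (hd n).2⟩,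
      (Finsupp.sum_add_index' (fun _ => rfl) fun _ _ _ => rfl).symm⟩
  | smul k a _ ha =>
    obtain ⟨c, hc, rfl⟩ := ha
    exact ⟨k • c, fun n => ⟨Submodule.smul_mem _ k (hc n).1, Submodule.smul_mem _ k (hc n).2⟩,
      by rw [Finsupp.sum_smul_index' fun _ => rfl, Finsupp.smul_sum]⟩
  | mem a ha =>
    obtain ⟨m, m', x, hx, rfl⟩ := ha
    refine ⟨Finsupp.single (wordDegree (m * FreeSemigroup.of (.vertex x) * m'))
      (mk K G (freeWord K (m * FreeSemigroup.of (.vertex x) * m'))), fun n => ?_, ?_⟩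
    swap; · exact (Finsupp.sum_single_index (h := fun _ b => b) rfl).symm
    rw [Finsupp.single_apply]
    split_ifs with h
    · exact ⟨Submodule.subset_span ⟨m, m', x, hx, rfl⟩, Submodule.subset_span ⟨_, h, rfl⟩⟩
    · exact ⟨Submodule.zero_mem _, Submodule.zero_mem _⟩

/-- The ideal generated by a hereditary saturated set contains no further vertices. -/
theorem vertexSet_vertexIdeal (hG : G.RowFinite) {H : Set V} (hH : G.IsHereditary H)
    (hS : G.IsSaturated H) : vertexSet (vertexIdeal K G H) = H := by
  ext x
  rw [mem_vertexSet, mem_vertexIdeal]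
  constructor
  · obtain ⟨φ, hφ⟩ := exists_representation (K := K) hG hH hS
    have hker : ∀ a ∈ vertexSpan K G H, a ∈ toSubmodule (TwoSidedIdeal.ker φ) := by
      refine fun a ha => Submodule.span_le.2 ?_ ha
      rintro _ ⟨m, m', y, hy, rfl⟩
      have : φ (mk K G (freeWord K (.of (.vertex y)))) = 0 := (hφ y).2 hy
      rw [SetLike.mem_coe, mem_toSubmodule, TwoSidedIdeal.mem_ker, mk_freeWord_mul,
        mk_freeWord_mul, map_mul, map_mul, this, mul_zero, zero_mul]
    intro hx
    exact (hφ x).1 ((TwoSidedIdeal.mem_ker φ).1 (hker _ hx))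
  · intro hx
    refine Submodule.subset_span ⟨.of (.vertex x), .of (.vertex x), x, hx, ?_⟩
    rw [mk_freeWord_mul, mk_freeWord_mul]
    change vtx K G x = vtx K G x * vtx K G x * vtx K G x
    rw [vtx_mul_self, vtx_mul_self]

theorem acc_hsClosure_of_acc_graded (hG : G.RowFinite)
    (hacc : SatisfiesACC {I : TwoSidedIdeal (LeavittPathAlgebra K G) // IsGradedIdeal I}) :
    SatisfiesACC {H : Set V // ∃ X : Set V, H = G.hsClosure X} := by
  intro a ha
  obtain ⟨n, hn⟩ := hacc (fun i => ⟨vertexIdeal K G (a i), isGradedIdeal_vertexIdeal _⟩)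
    fun i => vertexIdeal_mono (ha i)
  have hvert (i : ℕ) : vertexSet (vertexIdeal K G (a i : Set V)) = a i := by
    obtain ⟨X, hX⟩ := (a i).2
    rw [hX]
    exact vertexSet_vertexIdeal hG (isHereditary_hsClosure X) (isSaturated_hsClosure X)
  refine ⟨n, fun i hi => Subtype.ext ?_⟩
  rw [← hvert i, ← hvert n]
  exact congrArg (vertexSet ·.1) (hn i hi)

end LeavittPathAlgebra

theorem mainTheorem2 {K : Type w} [Field K] {V : Type u} {E : Type v}
    (G : DirectedGraph V E) (hG : G.RowFinite) :
    List.TFAE [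
      SatisfiesACC (TwoSidedIdeal (LeavittPathAlgebra K G)),
      SatisfiesACC {I : TwoSidedIdeal (LeavittPathAlgebra K G) //
        LeavittPathAlgebra.IsGradedIdeal I},
      SatisfiesACC {H : Set V // ∃ X : Set V, H = G.hsClosure X}] := by
  tfae_have 1 → 2 := fun h I hI => by
    obtain ⟨n, hn⟩ := h (fun i => I i) hI
    exact ⟨n, fun i hi => Subtype.ext (hn i hi)⟩
  tfae_have 2 → 3 := LeavittPathAlgebra.acc_hsClosure_of_acc_graded hG
  tfae_have 3 → 1 := LeavittPathAlgebra.acc_ideals_of_acc_hsClosure hG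
  tfae_finish
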